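/- A convex body is a non-empty compact convex subset of $\mathbb{R}^n$. Let $C\subset\mathbb{R}^n$ be a convex body with non-empty interior. For a convex body $K\subset\mathbb{R}^n$ let \[ R(K,C)=\min\{\lambda\ge 0 : K\subset c+\lambda C \text{ for some } c\in\mathbb{R}^n\}, \qquad D(K,C)=2\max\{R([x,y],C) : x,y\in K\}, \] where $[x,y]$ is the segment with endpoints $x,y$, and let \[ w(K,C)=\min_{s\ne 0}\frac{2\,h(K-K,s)}{h(C-C,s)}, \qquad h(A,s)=\max_{x\in A}s^Tx . \] The body $K$ is called complete with respect to $C$ if $D(K',C)>D(K,C)$ for every convex body $K'\supsetneq K$, and of constant width with respect to $C$ if $w(K,C)=D(K,C)$. The body $C$ (and the generalized Minkowski space it induces) is called perfect if every convex body that is complete with respect to $C$ is of constant width with respect to $C$. Let $n=2$ and let $C\subset\mathbb{R}^2$ be a convex body with non-empty interior. Then every convex body $K\subset\mathbb{R}^2$ that is complete with respect to $C$ satisfies \[ K-K=\frac{D(K,C)}{2}\,(C-C). \] Moreover, $C$ is perfect; hence all two-dimensional generalized Minkowski spaces are perfect. -/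

import Mathlib

open scoped Pointwise

noncomputable section

/-- The circumradius `R(K, C)`: the smallest `r ≥ 0` such that some translate of `r C`
contains `K`. -/
def gaugeCircumradius {n : ℕ} (K C : Set (EuclideanSpace ℝ (Fin n))) : ℝ :=
  sInf {r : ℝ | 0 ≤ r ∧ ∃ c : EuclideanSpace ℝ (Fin n), K ⊆ c +ᵥ r • C}

/-- The diameter `D(K, C) = 2 max {R([x, y], C) : x, y ∈ K}`. -/
def gaugeDiam {n : ℕ} (K C : Set (EuclideanSpace ℝ (Fin n))) : ℝ :=
  2 * sSup {r : ℝ | ∃ x ∈ K, ∃ y ∈ K, r = gaugeCircumradius (segment ℝ x y) C}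

/-- The support function `h(K, a) = max {aᵀ x : x ∈ K}`. -/
def supportFn {n : ℕ} (K : Set (EuclideanSpace ℝ (Fin n))) (a : EuclideanSpace ℝ (Fin n)) : ℝ :=
  sSup {r : ℝ | ∃ x ∈ K, r = inner ℝ a x}

/-- The breadth `b_s(K, C) = 2 h(K - K, s) / h(C - C, s)` in direction `s ≠ 0`. -/
def gaugeBreadth {n : ℕ} (K C : Set (EuclideanSpace ℝ (Fin n)))
    (s : EuclideanSpace ℝ (Fin n)) : ℝ :=
  2 * supportFn (K - K) s / supportFn (C - C) s

/-- The minimal width `w(K, C) = min {b_s(K, C) : s ≠ 0}`. -/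
def gaugeWidth {n : ℕ} (K C : Set (EuclideanSpace ℝ (Fin n))) : ℝ :=
  sInf {r : ℝ | ∃ s : EuclideanSpace ℝ (Fin n), s ≠ 0 ∧ r = gaugeBreadth K C s}

/-- `K` is (diametrically) complete with respect to `C`: every convex body properly containing
`K` has a larger diameter. -/
def IsGaugeComplete {n : ℕ} (K C : ConvexBody (EuclideanSpace ℝ (Fin n))) : Prop :=
  ∀ K' : ConvexBody (EuclideanSpace ℝ (Fin n)),
    (K : Set (EuclideanSpace ℝ (Fin n))) ⊂ K' → gaugeDiam (n := n) K C < gaugeDiam (n := n) K' C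

/-- `K` is of constant width with respect to `C`: its minimal width equals its diameter. -/
def HasConstantGaugeWidth {n : ℕ} (K C : ConvexBody (EuclideanSpace ℝ (Fin n))) : Prop :=
  gaugeWidth (n := n) K C = gaugeDiam (n := n) K C

/-- `C` (and the generalized Minkowski space that it induces) is perfect: each convex body that
is complete with respect to `C` is of constant width with respect to `C`. -/
def IsPerfectGauge {n : ℕ} (C : ConvexBody (EuclideanSpace ℝ (Fin n))) : Prop :=
  ∀ K : ConvexBody (EuclideanSpace ℝ (Fin n)), IsGaugeComplete K C → HasConstantGaugeWidth K C

end

/-! Let `p` be the gauge of `C - C` and `δ = D(K, C) / 2`, the `p`-diameter of `K`. Completeness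
means that a point within `δ` of all of `K` lies in `K` (`IsGaugeComplete.mem_of_forall_gauge_le`),
so each frontier point ends a chord of length `δ`. Fix `u` with `p u = δ`. Frontier points with such
a chord on one side of the line `ℝu`, and those with one on the other side, form two closed sets
covering the connected frontier; hence some `x` has diametral chords `x - y₁`, `x - y₂` on both
sides. If neither is parallel to `u`, then `u` or `-u` lies in their cone, and by
`Seminorm.sub_le_of_mem_cone` `x - u` or `x + u` is within `δ` of `K`, hence in `K`. So `u ∈ K - K`;
scaling gives `K - K = δ(C - C)`, and all breadths equal `2δ`. -/

/-- A linear functional with values `g₁`, `g₂` on two vectors that is larger at `(a, b)` than at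
both of them is a non-negative combination of `(1, s)` and `(t, 1)`. -/
theorem planar_cone_inequality {a b α β s t g₁ g₂ : ℝ} (ha : 0 ≤ a) (hb : 0 ≤ b) (hab : 1 ≤ a + b)
    (s0 : 0 ≤ s) (s1 : s ≤ 1) (t0 : 0 ≤ t) (t1 : t ≤ 1)
    (e₁ : a + b * s ≤ 1) (e₂ : a * t + b ≤ 1) (w₁ : 0 ≤ α + β * s) (w₂ : 0 ≤ α * t + β)
    (c₁ : g₁ < a * g₁ + b * g₂) (c₂ : g₂ < a * g₁ + b * g₂) (c₃ : α * g₁ + β * g₂ < 0) :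
    False := by
  have bs := mul_nonneg hb s0
  have hat := mul_nonneg ha t0
  have a1 : a ≤ 1 := by linarith
  have b1 : b ≤ 1 := by linarith
  have p₁ : 0 < g₁ := by
    by_contra! h
    have h1 : a * g₁ ≤ 0 := mul_nonpos_of_nonneg_of_nonpos ha h
    rcases le_or_gt g₂ 0 with h' | h'
    · rcases le_total g₁ g₂ with h'' | h''
      · nlinarith [mul_le_mul_of_nonneg_left h'' ha]
      · nlinarith [mul_le_mul_of_nonneg_left h'' hb]
    · nlinarith [mul_le_mul_of_nonneg_right b1 h'.le]
  have p₂ : 0 < g₂ := by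
    by_contra! h
    nlinarith [mul_nonpos_of_nonneg_of_nonpos hb h, mul_le_mul_of_nonneg_right a1 p₁.le]
  have q₁ : s * g₁ < g₂ := by
    by_contra! h
    nlinarith [mul_le_mul_of_nonneg_left h hb, mul_le_mul_of_nonneg_right e₁ p₁.le]
  have q₂ : t * g₂ < g₁ := by
    by_contra! h
    nlinarith [mul_le_mul_of_nonneg_left h ha, mul_le_mul_of_nonneg_right e₂ p₂.le]
  have st : s * t < 1 := by
    by_contra! h
    have hs : s = 1 := by nlinarith
    have ht : t = 1 := by nlinarith
    rw [hs] at q₁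
    rw [ht] at q₂
    linarith
  -- Cramer's rule for `(g₁, g₂)` in the basis `(1, s)`, `(t, 1)`; `q₁` and `q₂` make both
  -- coordinates positive.
  have h : (1 - s * t) * (α * g₁ + β * g₂) =
      (g₁ - t * g₂) * (α + β * s) + (g₂ - s * g₁) * (α * t + β) := by ring
  have h₁ := mul_nonneg (sub_nonneg.2 q₂.le) w₁
  have h₂ := mul_nonneg (sub_nonneg.2 q₁.le) w₂
  have h₃ := mul_neg_of_pos_of_neg (sub_pos.2 st) c₃
  linarith

/-! ### Norming functionals and the cone lemma -/

section Seminorm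

variable {E : Type*} [AddCommGroup E] [Module ℝ E]

/-- A norming functional of a seminorm at a vector, scaled to take the value `1` there. -/
theorem Seminorm.exists_norming (p : Seminorm ℝ E) {u : E} (hu : 0 < p u) :
    ∃ f : E →ₗ[ℝ] ℝ, f u = 1 ∧ ∀ x, f x ≤ p x / p u := by
  have hu0 : u ≠ 0 := fun h => by simp [h] at hu
  obtain ⟨g, hg, hgp⟩ := exists_extension_of_le_sublinear
    (LinearPMap.mkSpanSingleton u (1 : ℝ) hu0) (fun x => p x / p u)
    (fun c hc x => by
      simp only [map_smul_eq_mul, Real.norm_eq_abs, abs_of_pos hc]; ring)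
    (fun x y => by
      rw [← add_div]; gcongr; exact map_add_le_add p x y)
    (by
      rintro ⟨x, hx⟩
      obtain ⟨c, rfl⟩ := Submodule.mem_span_singleton.1 hx
      rw [LinearPMap.mkSpanSingleton'_apply]
      simp only [RingHom.id_apply, smul_eq_mul, mul_one, map_smul_eq_mul, Real.norm_eq_abs]
      rw [mul_div_assoc, div_self hu.ne', mul_one]
      exact le_abs_self c)
  refine ⟨g, ?_, hgp⟩
  exact (hg ⟨u, Submodule.mem_span_singleton_self u⟩).trans
    (LinearPMap.mkSpanSingleton'_apply_self _ _ _ _)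

/-- If `w` is in the balls of radius `δ` about `u₁` and `u₂`, it is in the ball of radius `δ` about
each vector `u` of length `δ` in the cone spanned by `u₁` and `u₂`. -/
theorem Seminorm.sub_le_of_mem_cone (p : Seminorm ℝ E) {δ a b α β : ℝ} {u₁ u₂ u w : E}
    (hδ : 0 < δ) (h₁ : p u₁ = δ) (h₂ : p u₂ = δ) (hu : p u = δ) (h₁₂ : p (u₁ - u₂) ≤ δ)
    (ha : 0 ≤ a) (hb : 0 ≤ b) (hab : u = a • u₁ + b • u₂) (hw : w = α • u₁ + β • u₂)
    (hw₁ : p (w - u₁) ≤ δ) (hw₂ : p (w - u₂) ≤ δ) : p (w - u) ≤ δ := by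
  by_contra! hlt
  obtain ⟨ψ₁, hψ₁, hψ₁p⟩ := p.exists_norming (h₁ ▸ hδ)
  obtain ⟨ψ₂, hψ₂, hψ₂p⟩ := p.exists_norming (h₂ ▸ hδ)
  obtain ⟨φ, hφ, hφp⟩ := p.exists_norming (hδ.trans hlt)
  have key₁ : ∀ x, p x ≤ δ → ψ₁ x ≤ 1 := fun x hx =>
    (hψ₁p x).trans (by rw [h₁]; exact (div_le_one hδ).2 hx)
  have key₂ : ∀ x, p x ≤ δ → ψ₂ x ≤ 1 := fun x hx =>
    (hψ₂p x).trans (by rw [h₂]; exact (div_le_one hδ).2 hx)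
  have keyφ : ∀ x, p x ≤ δ → φ x < 1 := fun x hx =>
    (hφp x).trans_lt ((div_lt_one (hδ.trans hlt)).2 (hx.trans_lt hlt))
  have e₁ := key₁ u hu.le
  have e₂ := key₂ u hu.le
  have s₁ := key₁ u₂ h₂.le
  have t₁ := key₂ u₁ h₁.le
  have s₀ := key₁ (u₁ - u₂) h₁₂
  have t₀ := key₂ (u₂ - u₁) (by rwa [map_sub_rev])
  have w₁ := key₁ (u₁ - w) (by rwa [map_sub_rev])
  have w₂ := key₂ (u₂ - w) (by rwa [map_sub_rev])
  have f₁ := keyφ (w - u₁) hw₁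
  have f₂ := keyφ (w - u₂) hw₂
  have f₀ := keyφ (-u) (by rw [map_neg_eq_map, hu])
  have hab1 : 1 ≤ a + b := by
    have : p u ≤ a * δ + b * δ := by
      rw [hab]
      refine (map_add_le_add p _ _).trans ?_
      simp [map_smul_eq_mul, abs_of_nonneg, ha, hb, h₁, h₂]
    rw [hu] at this
    nlinarith
  subst hab hw
  simp only [map_add, map_sub, map_neg, map_smul, smul_eq_mul, hψ₁, hψ₂, mul_one]
    at e₁ e₂ s₁ t₁ s₀ t₀ w₁ w₂ f₁ f₂ f₀ hφ
  -- As `φ` separates `w - u` from the ball of radius `δ`, `-φ` is larger at `u` than at `u₁` and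
  -- `u₂`, and negative at `w`.
  exact planar_cone_inequality (g₁ := -φ u₁) (g₂ := -φ u₂) (α := α) (β := β) (s := ψ₁ u₂)
    (t := ψ₂ u₁) ha hb hab1
    (by linarith) s₁ (by linarith) t₁ (by linarith) (by linarith) (by linarith) (by linarith)
    (by linarith) (by linarith) (by linarith)

end Seminorm

/-! ### Frontier points and diametral chords -/

section Frontier

variable {E : Type*} [NormedAddCommGroup E] [NormedSpace ℝ E]

/-- The frontier of a bounded closed convex set in dimension at least two is connected. -/
theorem Convex.isPreconnected_frontier {K : Set E} (hK : Convex ℝ K) (hcl : IsClosed K)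
    (hb : Bornology.IsBounded K) (hE : 1 < Module.rank ℝ E) : IsPreconnected (frontier K) := by
  rcases (interior K).eq_empty_or_nonempty with h | h
  · rw [hcl.frontier_eq, h, Set.sdiff_empty]
    exact hK.isPreconnected
  · obtain ⟨e, -, -, he⟩ := exists_homeomorph_image_interior_closure_frontier_eq_unitBall hK h hb
    have : frontier K = e.symm '' Metric.sphere 0 1 := by
      rw [← he, ← Set.image_comp]; simp
    rw [this]
    exact (isPreconnected_sphere hE 0 1).image _ e.symm.continuous.continuousOn

/-- If `K` has the ball intersection property for radius `δ`, each frontier point of `K` is the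
endpoint of a chord of length at least `δ`. -/
theorem exists_le_of_mem_frontier {p : Seminorm ℝ E} (hp : Continuous p) {K : Set E}
    (hK : IsCompact K) (hne : K.Nonempty) {δ : ℝ}
    (hball : ∀ z, (∀ x ∈ K, p (x - z) ≤ δ) → z ∈ K) {x : E} (hx : x ∈ frontier K) :
    ∃ y ∈ K, δ ≤ p (x - y) := by
  by_contra! h
  obtain ⟨y, hy, hmax⟩ := hK.exists_isMaxOn hne
    (f := fun y => p (x - y)) (by fun_prop)
  -- `y` is farthest from `x`; moving `x` by less than the slack keeps all of `K` within `δ`, so `x`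
  -- would be interior.
  have hU : {z | p (x - z) < δ - p (x - y)} ∈ nhds x := by
    refine IsOpen.mem_nhds (isOpen_lt (by fun_prop) continuous_const) ?_
    simpa using h y hy
  refine hx.2 (mem_interior_iff_mem_nhds.2 (Filter.mem_of_superset hU fun z hz => ?_))
  refine hball z fun v hv => ?_
  have h1 : p (x - v) ≤ p (x - y) := hmax hv
  have h2 : p (v - z) ≤ p (v - x) + p (x - z) := by
    simpa using map_add_le_add p (v - x) (x - z)
  rw [map_sub_rev p v x] at h2
  have h3 : p (x - z) < δ - p (x - y) := hz
  linarith

/-- The endpoints of a diametral chord are frontier points. -/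
theorem mem_frontier_of_diametral {p : Seminorm ℝ E} {K : Set E} {δ : ℝ} (hδ : 0 < δ)
    (hdiam : ∀ x ∈ K, ∀ y ∈ K, p (x - y) ≤ δ) {x y : E} (hx : x ∈ K) (hy : y ∈ K)
    (hxy : p (x - y) = δ) : y ∈ frontier K := by
  refine ⟨subset_closure hy, fun hint => ?_⟩
  have hc : Continuous fun t : ℝ => y + t • (y - x) := by fun_prop
  have h0 : (fun t : ℝ => y + t • (y - x)) ⁻¹' K ∈ nhds (0 : ℝ) :=
    hc.continuousAt.preimage_mem_nhds (by simpa using mem_interior_iff_mem_nhds.1 hint)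
  obtain ⟨ε, hε, hball⟩ := Metric.mem_nhds_iff.1 h0
  -- The chord prolonged beyond `y` would be longer than `δ`.
  have hm : y + (ε / 2) • (y - x) ∈ K :=
    hball (by simp [abs_of_pos hε, hε])
  have := hdiam x hx _ hm
  rw [show x - (y + (ε / 2) • (y - x)) = (1 + ε / 2) • (x - y) by module, map_smul_eq_mul, hxy,
    Real.norm_eq_abs, abs_of_pos (by positivity)] at this
  nlinarith

end Frontier

/-! ### Diametral chords in every planar direction -/

section Plane

/-- The planar cross product with `u`, as a linear functional. -/
def planarCross (u : EuclideanSpace ℝ (Fin 2)) : EuclideanSpace ℝ (Fin 2) →ₗ[ℝ] ℝ where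
  toFun x := u 0 * x 1 - u 1 * x 0
  map_add' x y := by simp; ring
  map_smul' c x := by simp; ring

theorem planarCross_apply (u x : EuclideanSpace ℝ (Fin 2)) :
    planarCross u x = u 0 * x 1 - u 1 * x 0 := rfl

theorem exists_smul_of_planarCross_eq_zero {u x : EuclideanSpace ℝ (Fin 2)} (hu : u ≠ 0)
    (h : planarCross u x = 0) : ∃ c : ℝ, x = c • u := by
  rw [planarCross_apply] at h
  by_cases h0 : u 0 = 0
  · have h1 : u 1 ≠ 0 := fun h1 => hu (by ext i; fin_cases i <;> simp [h0, h1])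
    have hx : x 0 = 0 := by simpa [h0, h1] using h
    refine ⟨x 1 / u 1, ?_⟩
    ext i; fin_cases i
    · simp [h0, hx]
    · simp [h1]
  · refine ⟨x 0 / u 0, ?_⟩
    ext i; fin_cases i
    · simp [h0]
    · simp only [Fin.mk_one, PiLp.smul_apply, smul_eq_mul]
      field_simp
      linarith

variable {p : Seminorm ℝ (EuclideanSpace ℝ (Fin 2))} {K : Set (EuclideanSpace ℝ (Fin 2))} {δ : ℝ}

/-- For `z ∈ K` the cone lemma applies to `w = x - z`, because `w - (x - yᵢ) = yᵢ - z`. Thus `x - u`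
is within `δ` of all of `K`. -/
theorem mem_sub_of_cone (hδ : 0 < δ) (hdiam : ∀ x ∈ K, ∀ y ∈ K, p (x - y) ≤ δ)
    (hball : ∀ z, (∀ x ∈ K, p (x - z) ≤ δ) → z ∈ K) {x y₁ y₂ u : EuclideanSpace ℝ (Fin 2)}
    (hx : x ∈ K) (hy₁ : y₁ ∈ K) (hy₂ : y₂ ∈ K) (h₁ : p (x - y₁) = δ) (h₂ : p (x - y₂) = δ)
    (hu : p u = δ) {a b : ℝ} (ha : 0 ≤ a) (hb : 0 ≤ b) (hab : u = a • (x - y₁) + b • (x - y₂))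
    (hspan : ∀ w, ∃ α β : ℝ, w = α • (x - y₁) + β • (x - y₂)) : u ∈ K - K := by
  refine ⟨x, hx, x - u, hball _ fun z hz => ?_, by simp⟩
  obtain ⟨α, β, hw⟩ := hspan (x - z)
  have := p.sub_le_of_mem_cone hδ h₁ h₂ hu
    (by rw [sub_sub_sub_cancel_left]; exact hdiam _ hy₂ _ hy₁) ha hb hab hw
    (by rw [sub_sub_sub_cancel_left]; exact hdiam _ hy₁ _ hz)
    (by rw [sub_sub_sub_cancel_left]; exact hdiam _ hy₂ _ hz)
  rw [map_sub_rev]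
  convert this using 2
  abel

theorem neg_mem_sub_self {E : Type*} [AddCommGroup E] {K : Set E} {x : E} (h : x ∈ K - K) :
    -x ∈ K - K := by
  obtain ⟨a, ha, b, hb, rfl⟩ := h
  exact ⟨b, hb, a, ha, by simp⟩

theorem mem_sub_of_parallel {E : Type*} [AddCommGroup E] [Module ℝ E] {p : Seminorm ℝ E}
    {K : Set E} {δ : ℝ} (hδ : 0 < δ) {u v : E} (hu : p u = δ) (hv : p v = δ)
    (hvK : v ∈ K - K) {c : ℝ} (h : v = c • u) : u ∈ K - K := by
  have hc : |c| = 1 := by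
    rw [h, map_smul_eq_mul, hu, Real.norm_eq_abs] at hv
    exact mul_right_cancel₀ hδ.ne' (hv.trans (one_mul δ).symm)
  rcases eq_or_eq_neg_of_abs_eq hc with rfl | rfl
  · rwa [h, one_smul] at hvK
  · simpa [h] using neg_mem_sub_self hvK

/-- A planar body with the ball intersection property that has diameter `δ` attains the diameter in
each direction. -/
theorem mem_sub_of_seminorm_eq (hp : Continuous p) (hKc : Convex ℝ K) (hK : IsCompact K)
    (hne : K.Nonempty) (hδ : 0 < δ) (hdiam : ∀ x ∈ K, ∀ y ∈ K, p (x - y) ≤ δ)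
    (hball : ∀ z, (∀ x ∈ K, p (x - z) ≤ δ) → z ∈ K) {u : EuclideanSpace ℝ (Fin 2)}
    (hu : p u = δ) : u ∈ K - K := by
  have hu0 : u ≠ 0 := fun h => by simp [h] at hu; exact hδ.ne hu
  have hcont : Continuous (planarCross u) := (planarCross u).continuous_of_finiteDimensional
  -- Endpoints of diametral chords on a prescribed side of `ℝu`; closed as projections of compact
  -- sets when `S` is closed.
  let side : Set ℝ → Set (EuclideanSpace ℝ (Fin 2)) := fun S => Prod.fst ''
    (K ×ˢ K ∩ {q | p (q.1 - q.2) = δ ∧ planarCross u (q.1 - q.2) ∈ S})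
  have hside : ∀ S, IsClosed S → IsClosed (side S) := fun S hS =>
    ((hK.prod hK).inter_right ((isClosed_eq (by fun_prop) continuous_const).inter
      (hS.preimage (by fun_prop)))).image continuous_fst |>.isClosed
  have hmem : ∀ S x y, x ∈ K → y ∈ K → p (x - y) = δ → planarCross u (x - y) ∈ S → x ∈ side S :=
    fun S x y hx hy h1 h2 => ⟨(x, y), ⟨⟨hx, hy⟩, h1, h2⟩, rfl⟩
  have hpartner : ∀ x ∈ frontier K, ∃ y ∈ K, p (x - y) = δ := fun x hx => by
    obtain ⟨y, hy, h⟩ := exists_le_of_mem_frontier hp hK hne hball hx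
    exact ⟨y, hy, (hdiam x (hK.isClosed.frontier_subset hx) y hy).antisymm h⟩
  have hcover : frontier K ⊆ side (Set.Ici 0) ∪ side (Set.Iic 0) := fun x hx => by
    obtain ⟨y, hy, h⟩ := hpartner x hx
    rcases le_total 0 (planarCross u (x - y)) with h' | h'
    · exact Or.inl (hmem _ x y (hK.isClosed.frontier_subset hx) hy h h')
    · exact Or.inr (hmem _ x y (hK.isClosed.frontier_subset hx) hy h h')
  obtain ⟨x₀, hx₀⟩ : (frontier K).Nonempty :=
    nonempty_frontier_iff.2 ⟨hne, fun h => NoncompactSpace.noncompact_univ (h ▸ hK)⟩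
  have hx₀K := hK.isClosed.frontier_subset hx₀
  obtain ⟨y₀, hy₀, h₀⟩ := hpartner x₀ hx₀
  have hy₀f := mem_frontier_of_diametral hδ hdiam hx₀K hy₀ h₀
  have h₀' : p (y₀ - x₀) = δ := by rw [map_sub_rev, h₀]
  have hneg : planarCross u (y₀ - x₀) = -planarCross u (x₀ - y₀) := by
    rw [← map_neg, neg_sub]
  -- Reversing a chord switches its side, so the two ends of a single chord serve both sets.
  obtain ⟨hL, hR⟩ : (frontier K ∩ side (Set.Ici 0)).Nonempty ∧
      (frontier K ∩ side (Set.Iic 0)).Nonempty := by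
    rcases le_total 0 (planarCross u (x₀ - y₀)) with h | h
    · exact ⟨⟨x₀, hx₀, hmem _ x₀ y₀ hx₀K hy₀ h₀ h⟩,
        ⟨y₀, hy₀f, hmem _ y₀ x₀ hy₀ hx₀K h₀' (by rw [hneg]; simpa using h)⟩⟩
    · exact ⟨⟨y₀, hy₀f, hmem _ y₀ x₀ hy₀ hx₀K h₀' (by rw [hneg]; simpa using h)⟩,
        ⟨x₀, hx₀, hmem _ x₀ y₀ hx₀K hy₀ h₀ h⟩⟩
  have hrank : 1 < Module.rank ℝ (EuclideanSpace ℝ (Fin 2)) := by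
    rw [← Module.finrank_eq_rank, finrank_euclideanSpace_fin]
    norm_num
  obtain ⟨x, -, ⟨⟨x₁, y₁⟩, ⟨⟨hx, hy₁⟩, h₁, hc₁⟩, rfl⟩, ⟨⟨x₂, y₂⟩, ⟨⟨-, hy₂⟩, h₂, hc₂⟩, hx₂⟩⟩ :=
    isPreconnected_closed_iff.1 (hKc.isPreconnected_frontier hK.isClosed hK.isBounded hrank) _ _
      (hside _ isClosed_Ici) (hside _ isClosed_Iic) hcover hL hR
  obtain rfl : x₂ = x₁ := hx₂
  simp only [Set.mem_Ici, Set.mem_Iic] at hx hy₁ hy₂ h₁ h₂ hc₁ hc₂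
  rcases hc₁.eq_or_lt with hc₁ | hc₁
  · obtain ⟨c, hc⟩ := exists_smul_of_planarCross_eq_zero hu0 hc₁.symm
    exact mem_sub_of_parallel hδ hu h₁ (Set.sub_mem_sub hx hy₁) hc
  rcases hc₂.eq_or_lt with hc₂ | hc₂
  · obtain ⟨c, hc⟩ := exists_smul_of_planarCross_eq_zero hu0 hc₂
    exact mem_sub_of_parallel hδ hu h₂ (Set.sub_mem_sub hx hy₂) hc
  obtain ⟨m₁, hm₁⟩ : ∃ m, m = planarCross u (x₂ - y₁) := ⟨_, rfl⟩
  obtain ⟨m₂, hm₂⟩ : ∃ m, m = -planarCross u (x₂ - y₂) := ⟨_, rfl⟩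
  have m₁0 : 0 < m₁ := hm₁ ▸ hc₁
  have m₂0 : 0 < m₂ := by rw [hm₂]; exact neg_pos.2 hc₂
  -- The weights `m₂`, `m₁` cancel the cross products, so the positive combination lies on `ℝu`.
  obtain ⟨c, hc⟩ := exists_smul_of_planarCross_eq_zero hu0
    (x := m₂ • (x₂ - y₁) + m₁ • (x₂ - y₂)) (by
      rw [map_add, map_smul, map_smul, ← hm₁, ← neg_eq_iff_eq_neg.2 hm₂]
      simp only [smul_eq_mul]; ring)
  -- Otherwise the two chords are opposite and `y₂ - y₁` has length `2δ`.
  have hc0 : c ≠ 0 := by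
    rintro rfl
    rw [zero_smul, add_eq_zero_iff_eq_neg] at hc
    have hm : m₂ = m₁ := by
      have := congrArg p hc
      rw [map_neg_eq_map, map_smul_eq_mul, map_smul_eq_mul, h₁, h₂, Real.norm_eq_abs,
        Real.norm_eq_abs, abs_of_pos m₁0, abs_of_pos m₂0] at this
      exact mul_right_cancel₀ hδ.ne' this
    rw [hm, ← smul_neg] at hc
    have hv := smul_right_injective _ m₁0.ne' hc
    have h := hdiam y₂ hy₂ y₁ hy₁
    rw [show y₂ - y₁ = (x₂ - y₁) - (x₂ - y₂) by abel, hv,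
      show -(x₂ - y₂) - (x₂ - y₂) = (-2 : ℝ) • (x₂ - y₂) by module, map_smul_eq_mul, h₂] at h
    norm_num at h
    linarith
  have hu' : u = (m₂ / c) • (x₂ - y₁) + (m₁ / c) • (x₂ - y₂) := by
    rw [div_eq_inv_mul, div_eq_inv_mul, mul_smul, mul_smul, ← smul_add, hc, inv_smul_smul₀ hc0]
  have hspan : ∀ w, ∃ α β : ℝ, w = α • (x₂ - y₁) + β • (x₂ - y₂) := fun w => by
    obtain ⟨d, hd⟩ := exists_smul_of_planarCross_eq_zero hu0
      (x := w - (planarCross u w / m₁) • (x₂ - y₁)) (by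
        rw [map_sub, map_smul, ← hm₁, smul_eq_mul, div_mul_cancel₀ _ m₁0.ne', sub_self])
    refine ⟨planarCross u w / m₁ + d * (m₂ / c), d * (m₁ / c), ?_⟩
    calc w = d • u + (planarCross u w / m₁) • (x₂ - y₁) := sub_eq_iff_eq_add.1 hd
      _ = d • ((m₂ / c) • (x₂ - y₁) + (m₁ / c) • (x₂ - y₂)) +
          (planarCross u w / m₁) • (x₂ - y₁) := by rw [← hu']
      _ = _ := by module
  rcases hc0.lt_or_gt with hneg | hpos
  · refine neg_neg u ▸ neg_mem_sub_self (mem_sub_of_cone hδ hdiam hball hx hy₁ hy₂ h₁ h₂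
      (by rw [map_neg_eq_map, hu]) (a := m₂ / -c) (b := m₁ / -c) ?_ ?_ ?_ hspan)
    · exact div_nonneg m₂0.le (neg_nonneg.2 hneg.le)
    · exact div_nonneg m₁0.le (neg_nonneg.2 hneg.le)
    · nth_rw 1 [hu']
      rw [div_neg, div_neg]
      module
  · exact mem_sub_of_cone hδ hdiam hball hx hy₁ hy₂ h₁ h₂ hu (div_nonneg m₂0.le hpos.le)
      (div_nonneg m₁0.le hpos.le) hu' hspan

end Plane

/-! ### Diameter, completeness and width via the gauge of `C - C` -/

section Gauge

variable {n : ℕ} {C K : Set (EuclideanSpace ℝ (Fin n))}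

theorem sub_self_mem_nhds_zero (hC : (interior C).Nonempty) : C - C ∈ nhds 0 := by
  obtain ⟨c, hc⟩ := hC
  exact mem_interior_iff_mem_nhds.1
    (subset_interior_sub_left ⟨c, hc, c, interior_subset hc, sub_self c⟩)

theorem IsCompact.sub_self (hC : IsCompact C) : IsCompact (C - C) := by
  rw [← Set.image2_sub, ← Set.image_prod]
  exact (hC.prod hC).image continuous_sub

theorem balanced_sub_self (hC : Convex ℝ C) : Balanced ℝ (C - C) :=
  (balanced_iff_neg_mem (hC.sub hC)).2 fun _ => neg_mem_sub_self

theorem mem_smul_iff_gauge_le {B : Set (EuclideanSpace ℝ (Fin n))} (hB : Convex ℝ B)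
    (hBc : IsCompact B) (hB₀ : B ∈ nhds 0) {r : ℝ} (hr : 0 ≤ r) {x : EuclideanSpace ℝ (Fin n)} :
    x ∈ r • B ↔ gauge B x ≤ r := by
  refine ⟨gauge_le_of_mem hr, fun h => ?_⟩
  rcases hr.eq_or_lt with rfl | hr
  · have h0 : gauge B x = 0 := h.antisymm (gauge_nonneg x)
    rw [gauge_eq_zero (absorbent_nhds_zero hB₀)
      (NormedSpace.isVonNBounded_of_isBounded ℝ hBc.isBounded)] at h0
    exact ⟨0, mem_of_mem_nhds hB₀, by simp [h0]⟩
  · rw [Set.mem_smul_set_iff_inv_smul_mem₀ hr.ne', ← hBc.isClosed.closure_eq,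
      ← gauge_le_one_iff_mem_closure hB hB₀, gauge_smul_of_nonneg (inv_nonneg.2 hr.le),
      smul_eq_mul, inv_mul_le_one₀ hr]
    exact h

/-- The circumradius of a segment is the length of its difference vector in the gauge of `C - C`. -/
theorem gaugeCircumradius_segment (hC : Convex ℝ C) (hCc : IsCompact C)
    (hCi : (interior C).Nonempty) (x y : EuclideanSpace ℝ (Fin n)) :
    gaugeCircumradius (segment ℝ x y) C = gauge (C - C) (x - y) := by
  have key : ∀ r : ℝ, 0 ≤ r →
      ((∃ c : EuclideanSpace ℝ (Fin n), segment ℝ x y ⊆ c +ᵥ r • C) ↔ gauge (C - C) (x - y) ≤ r) :=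
    fun r hr => by
    rw [← mem_smul_iff_gauge_le (hC.sub hC) hCc.sub_self (sub_self_mem_nhds_zero hCi) hr]
    constructor
    · rintro ⟨c, hc⟩
      obtain ⟨-, ⟨a, ha, rfl⟩, hx⟩ := hc (left_mem_segment ℝ x y)
      obtain ⟨-, ⟨b, hb, rfl⟩, hy⟩ := hc (right_mem_segment ℝ x y)
      refine ⟨a - b, Set.sub_mem_sub ha hb, ?_⟩
      rw [← hx, ← hy]
      simp [smul_sub]
    · rintro ⟨-, ⟨a, ha, b, hb, rfl⟩, h⟩
      -- This translation takes `r • a` to `x`, hence `r • b` to `y`.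
      refine ⟨x - r • a, ((hC.smul r).vadd _).segment_subset ?_ ?_⟩
      · exact ⟨r • a, Set.smul_mem_smul_set ha, by simp⟩
      · refine ⟨r • b, Set.smul_mem_smul_set hb, ?_⟩
        have h' : r • a - r • b = x - y := by rw [← h]; simp [smul_sub]
        simp only [vadd_eq_add]
        rw [sub_add, h', sub_sub_cancel]
  refine IsLeast.csInf_eq ⟨⟨gauge_nonneg _, (key _ (gauge_nonneg _)).2 le_rfl⟩, ?_⟩
  rintro r ⟨hr, h⟩
  exact (key r hr).1 h

theorem isLUB_gaugeDiam (hC : Convex ℝ C) (hCc : IsCompact C) (hCi : (interior C).Nonempty)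
    (hK : IsCompact K) (hne : K.Nonempty) :
    IsLUB {r : ℝ | ∃ x ∈ K, ∃ y ∈ K, r = gauge (C - C) (x - y)} (gaugeDiam K C / 2) := by
  have hc := continuous_gauge (hC.sub hC) (sub_self_mem_nhds_zero hCi)
  have hS : {r : ℝ | ∃ x ∈ K, ∃ y ∈ K, r = gauge (C - C) (x - y)} =
      (fun q : _ × _ => gauge (C - C) (q.1 - q.2)) '' (K ×ˢ K) := by
    ext r
    constructor
    · rintro ⟨x, hx, y, hy, rfl⟩
      exact ⟨(x, y), ⟨hx, hy⟩, rfl⟩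
    · rintro ⟨⟨x, y⟩, ⟨hx, hy⟩, rfl⟩
      exact ⟨x, hx, y, hy, rfl⟩
  have h : gaugeDiam K C / 2 = sSup {r : ℝ | ∃ x ∈ K, ∃ y ∈ K, r = gauge (C - C) (x - y)} := by
    simp only [gaugeDiam, gaugeCircumradius_segment hC hCc hCi]
    ring
  rw [h, hS]
  exact isLUB_csSup ((hne.prod hne).image _)
    ((hK.prod hK).image (by fun_prop)).bddAbove

theorem gauge_sub_le_gaugeDiam (hC : Convex ℝ C) (hCc : IsCompact C) (hCi : (interior C).Nonempty)
    (hK : IsCompact K) {x y : EuclideanSpace ℝ (Fin n)} (hx : x ∈ K) (hy : y ∈ K) :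
    gauge (C - C) (x - y) ≤ gaugeDiam K C / 2 :=
  (isLUB_gaugeDiam hC hCc hCi hK ⟨x, hx⟩).1 ⟨x, hx, y, hy, rfl⟩

/-- A complete body has the ball intersection property. -/
theorem IsGaugeComplete.mem_of_forall_gauge_le {K C : ConvexBody (EuclideanSpace ℝ (Fin n))}
    (hCi : (interior (C : Set (EuclideanSpace ℝ (Fin n)))).Nonempty) (h : IsGaugeComplete K C)
    (p : Seminorm ℝ (EuclideanSpace ℝ (Fin n)))
    (hp : ∀ x, p x = gauge (C - C : Set (EuclideanSpace ℝ (Fin n))) x)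
    {z : EuclideanSpace ℝ (Fin n)}
    (hz : ∀ x ∈ (K : Set (EuclideanSpace ℝ (Fin n))),
      p (x - z) ≤ gaugeDiam (K : Set (EuclideanSpace ℝ (Fin n))) C / 2) :
    z ∈ (K : Set (EuclideanSpace ℝ (Fin n))) := by
  by_contra hzK
  let S : Set (EuclideanSpace ℝ (Fin n)) := insert z K
  let δ := gaugeDiam (K : Set (EuclideanSpace ℝ (Fin n))) C / 2
  have hpc : Continuous p := by
    rw [funext hp]
    exact continuous_gauge (C.convex.sub C.convex) (sub_self_mem_nhds_zero hCi)
  have hdK : ∀ x ∈ (K : Set (EuclideanSpace ℝ (Fin n))), ∀ y ∈ (K : Set (EuclideanSpace ℝ (Fin n))),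
      p (x - y) ≤ δ := fun x hx y hy => by
    rw [hp]
    exact gauge_sub_le_gaugeDiam C.convex C.isCompact hCi K.isCompact hx hy
  obtain ⟨x₀, hx₀⟩ := K.nonempty
  have hδ : 0 ≤ δ := (apply_nonneg p _).trans (hdK x₀ hx₀ x₀ hx₀)
  have hS : ∀ x ∈ S, ∀ y ∈ S, p (x - y) ≤ δ := by
    rintro x (rfl | hx) y (rfl | hy)
    · simpa using hδ
    · rw [map_sub_rev]; exact hz y hy
    · exact hz x hx
    · exact hdK x hx y hy
  have hball : ∀ y, Convex ℝ {x | p (x - y) ≤ δ} ∧ IsClosed {x | p (x - y) ≤ δ} := fun y => by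
    refine ⟨?_, isClosed_le (by fun_prop) continuous_const⟩
    have : {x | p (x - y) ≤ δ} = p.closedBall y δ := by ext; simp [Seminorm.mem_closedBall]
    rw [this]
    exact p.convex_closedBall y δ
  -- Balls are closed and convex, so the bound passes to the hull one variable at a time: adding `z`
  -- does not increase the diameter.
  have h₁ : ∀ y ∈ S, ∀ x ∈ closedConvexHull ℝ S, p (x - y) ≤ δ := fun y hy =>
    closedConvexHull_min (fun x hx => hS x hx y hy) (hball y).1 (hball y).2
  have h₂ : ∀ y ∈ closedConvexHull ℝ S, ∀ x ∈ closedConvexHull ℝ S, p (x - y) ≤ δ := fun y hy =>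
    closedConvexHull_min (fun x hx => (map_sub_rev p x y).trans_le (h₁ x hx y hy))
      (hball y).1 (hball y).2
  have hcomp : IsCompact (closedConvexHull ℝ S) := by
    rw [closedConvexHull_eq_closure_convexHull]
    exact (isBounded_convexHull.2 ((K.isCompact.insert z).isBounded)).isCompact_closure
  let K' : ConvexBody (EuclideanSpace ℝ (Fin n)) :=
    ⟨closedConvexHull ℝ S, convex_closedConvexHull, hcomp,
      ⟨z, subset_closedConvexHull (Set.mem_insert z _)⟩⟩
  have hlt := h K' ⟨(Set.subset_insert z _).trans subset_closedConvexHull,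
    fun hsub => hzK (hsub (subset_closedConvexHull (Set.mem_insert z _)))⟩
  have hle : gaugeDiam (K' : Set (EuclideanSpace ℝ (Fin n))) C / 2 ≤ δ := by
    refine (isLUB_gaugeDiam C.convex C.isCompact hCi K'.isCompact K'.nonempty).2 ?_
    rintro - ⟨x, hx, y, hy, rfl⟩
    rw [← hp]
    exact h₂ y hy x hx
  have hδ' : δ = gaugeDiam (K : Set (EuclideanSpace ℝ (Fin n))) C / 2 := rfl
  linarith

theorem supportFn_pos {B : Set (EuclideanSpace ℝ (Fin n))} (hB : IsCompact B) (hB₀ : B ∈ nhds 0)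
    {s : EuclideanSpace ℝ (Fin n)} (hs : s ≠ 0) : 0 < supportFn B s := by
  have hc : Continuous fun t : ℝ => t • s := by fun_prop
  have h0 : (fun t : ℝ => t • s) ⁻¹' B ∈ nhds (0 : ℝ) :=
    hc.continuousAt.preimage_mem_nhds (by simpa using hB₀)
  obtain ⟨ε, hε, hball⟩ := Metric.mem_nhds_iff.1 h0
  have hm : (ε / 2) • s ∈ B := hball (by simp [abs_of_pos hε, hε])
  have hbdd : BddAbove {r : ℝ | ∃ x ∈ B, r = inner ℝ s x} := by
    refine (hB.image (f := fun x => inner ℝ s x) (by fun_prop)).bddAbove.mono ?_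
    rintro - ⟨x, hx, rfl⟩
    exact ⟨x, hx, rfl⟩
  refine lt_of_lt_of_le ?_ (le_csSup hbdd ⟨_, hm, rfl⟩)
  rw [real_inner_smul_right]
  have := real_inner_self_pos.2 hs
  positivity

theorem supportFn_smul {r : ℝ} (hr : 0 ≤ r) (B : Set (EuclideanSpace ℝ (Fin n)))
    (s : EuclideanSpace ℝ (Fin n)) : supportFn (r • B) s = r * supportFn B s := by
  rw [supportFn, supportFn, ← smul_eq_mul, ← Real.sSup_smul_of_nonneg hr]
  congr 1
  ext t
  constructor
  · rintro ⟨-, ⟨x, hx, rfl⟩, rfl⟩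
    exact ⟨inner ℝ s x, ⟨x, hx, rfl⟩, by simp [real_inner_smul_right]⟩
  · rintro ⟨-, ⟨x, hx, rfl⟩, rfl⟩
    exact ⟨r • x, Set.smul_mem_smul_set hx, by simp [real_inner_smul_right]⟩

/-- Every breadth is `2r`; `NeZero n` ensures that a direction exists, so the infimum is not over
the empty set. -/
theorem gaugeWidth_of_sub_eq [NeZero n] (hCc : IsCompact C) (hCi : (interior C).Nonempty) {r : ℝ}
    (hr : 0 ≤ r) (h : K - K = r • (C - C)) : gaugeWidth K C = 2 * r := by
  have hb : ∀ s : EuclideanSpace ℝ (Fin n), s ≠ 0 → gaugeBreadth K C s = 2 * r := fun s hs => by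
    have := supportFn_pos hCc.sub_self (sub_self_mem_nhds_zero hCi) hs
    rw [gaugeBreadth, h, supportFn_smul hr]
    field_simp
  have hS : {t : ℝ | ∃ s : EuclideanSpace ℝ (Fin n), s ≠ 0 ∧ t = gaugeBreadth K C s} = {2 * r} := by
    ext t
    constructor
    · rintro ⟨s, hs, rfl⟩
      exact hb s hs
    · rintro rfl
      obtain ⟨s, hs⟩ := exists_ne (0 : EuclideanSpace ℝ (Fin n))
      exact ⟨s, hs, (hb s hs).symm⟩
  rw [gaugeWidth, hS, csInf_singleton]

end Gauge

/-! ### The main theorem -/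

/-- In the plane, the difference body of a complete body is a ball. -/
theorem IsGaugeComplete.sub_self_eq {K C : ConvexBody (EuclideanSpace ℝ (Fin 2))}
    (hC : (interior (C : Set (EuclideanSpace ℝ (Fin 2)))).Nonempty) (h : IsGaugeComplete K C) :
    (K - K : Set (EuclideanSpace ℝ (Fin 2))) =
      (gaugeDiam (K : Set (EuclideanSpace ℝ (Fin 2))) C / 2) •
        (C - C : Set (EuclideanSpace ℝ (Fin 2))) := by
  have hB := C.convex.sub C.convex
  have hBc := C.isCompact.sub_self
  have hB₀ := sub_self_mem_nhds_zero hC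
  let p := gaugeSeminorm (balanced_sub_self C.convex) hB (absorbent_nhds_zero hB₀)
  have hpdef : ∀ x, p x = gauge (C - C : Set (EuclideanSpace ℝ (Fin 2))) x := fun _ => rfl
  have hp : Continuous p := continuous_gauge hB hB₀
  obtain ⟨δ, hδdef⟩ : ∃ δ, δ = gaugeDiam (K : Set (EuclideanSpace ℝ (Fin 2))) C / 2 := ⟨_, rfl⟩
  have hdiam : ∀ x ∈ (K : Set (EuclideanSpace ℝ (Fin 2))),
      ∀ y ∈ (K : Set (EuclideanSpace ℝ (Fin 2))), p (x - y) ≤ δ := fun x hx y hy =>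
    (gauge_sub_le_gaugeDiam C.convex C.isCompact hC K.isCompact hx hy).trans hδdef.ge
  obtain ⟨x₀, hx₀⟩ := K.nonempty
  have hδ0 : 0 ≤ δ := (apply_nonneg p _).trans (hdiam x₀ hx₀ x₀ hx₀)
  have hzero : (0 : EuclideanSpace ℝ (Fin 2)) ∈ (K - K : Set (EuclideanSpace ℝ (Fin 2))) :=
    ⟨x₀, hx₀, x₀, hx₀, sub_self x₀⟩
  rw [← hδdef]
  ext v
  rw [mem_smul_iff_gauge_le hB hBc hB₀ hδ0, ← hpdef]
  constructor
  · rintro ⟨x, hx, y, hy, rfl⟩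
    exact hdiam x hx y hy
  · intro hv
    rcases (apply_nonneg p v).eq_or_lt with h0 | hpos
    · have : v = 0 := (gauge_eq_zero (absorbent_nhds_zero hB₀)
        (NormedSpace.isVonNBounded_of_isBounded ℝ hBc.isBounded)).1 h0.symm
      rwa [this]
    · have hδ : 0 < δ := hpos.trans_le hv
      -- Stretch `v` to length `δ`, then shrink back inside the convex set `K - K`, which contains
      -- `0`.
      have hu : (δ / p v) • v ∈ (K - K : Set (EuclideanSpace ℝ (Fin 2))) := by
        refine mem_sub_of_seminorm_eq hp K.convex K.isCompact K.nonempty hδ hdiam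
          (fun z hz => h.mem_of_forall_gauge_le hC p hpdef (hδdef ▸ hz)) ?_
        rw [map_smul_eq_mul, Real.norm_eq_abs, abs_of_pos (div_pos hδ hpos),
          div_mul_cancel₀ _ hpos.ne']
      have := (K.convex.sub K.convex).smul_mem_of_zero_mem hzero hu
        (t := p v / δ) ⟨(div_pos hpos hδ).le, (div_le_one hδ).2 hv⟩
      rwa [smul_smul, div_mul_div_cancel₀ hδ.ne', div_self hpos.ne', one_smul] at this

theorem lemmal (C : ConvexBody (EuclideanSpace ℝ (Fin 2)))
    (hC : (interior (C : Set (EuclideanSpace ℝ (Fin 2)))).Nonempty) :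
    (∀ K : ConvexBody (EuclideanSpace ℝ (Fin 2)), IsGaugeComplete K C →
      (K : Set (EuclideanSpace ℝ (Fin 2))) - (K : Set (EuclideanSpace ℝ (Fin 2))) =
        (gaugeDiam (n := 2) K C / 2) •
          ((C : Set (EuclideanSpace ℝ (Fin 2))) - (C : Set (EuclideanSpace ℝ (Fin 2))))) ∧
    IsPerfectGauge C := by
  refine ⟨fun K hK => hK.sub_self_eq hC, fun K hK => ?_⟩
  obtain ⟨x, hx⟩ := K.nonempty
  have h0 := (gauge_nonneg _).trans
    (gauge_sub_le_gaugeDiam C.convex C.isCompact hC K.isCompact hx hx)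
  rw [HasConstantGaugeWidth, gaugeWidth_of_sub_eq C.isCompact hC h0 (hK.sub_self_eq hC)]
  ring
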